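/- Let $H=(V,E)$ be a finite undirected graph on $V=\{1,\dots,n\}$ (the key-sharing graph) and let $D$ be a set of data items with $|D|\ge 2$. Consider a $k$-round protocol $P$ among the players $V$, with a set $A\subseteq V$ of possible senders and a receiver $r\in V$ that is fixed beforehand, of the following kind. Every player $m$ has private random coins, and for every edge $\{i,j\}\in E$ the players $i$ and $j$, and nobody else, hold a random key $r_{i,j}$ (for example one uniform bit); all coins and keys are independent and discrete. In each round the players, one after another, publicly transmit one message, which all players receive; the message of player $m$ is a function of $m$'s coins, the keys on the edges at $m$, all messages transmitted before, and $m$'s role, namely whether $m$ is the sender and, if so, the data item $d\in D$ to be sent. At the end the receiver computes an element of $D$ from its coins, its keys and the sequence $C$ of all messages. Assume that $P$ is correct: for every sender $s\in A\setminus\{r\}$ and every $d\in D$, if all players follow the protocol, the receiver obtains $d$ with probability $1$. For a set $T\subseteq V$ of colluding players let $G^T$ be the coins of the members of $T$ together with all keys on edges meeting $T$. The sender is anonymous against $T$ if for every $d\in D$, when the sender $s$ of $d$ is uniformly distributed on $A\setminus T$ and independent of all coins and keys, $$\max_S \Pr[S(C,G^T)=s]=\frac1{|A\setminus T|},$$ the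 maximum being over all functions $S$ with values in $V$. (If $A=V$ and $|T|=t$, the right-hand side is $1/(n-t)$.) Suppose that $T$ separates two possible senders in $H$: there are $i,j\in A\setminus T$ such that every walk in $H$ from $i$ to $j$ meets $T$. (If $A=V$, this says that removing $T$ disconnects the key-sharing graph.) Then $T$ can break the sender's anonymity, even if its members follow the protocol and merely pool what they see: there are $d\in D$ and a function $S$ with $$\Pr[S(C,G^T)=s]>\frac1{|A\setminus T|}.$$ In particular, the sender is not anonymous against $T$. -/

import Mathlib

open scoped ENNReal

/-- An `n`-player protocol for transmitting one data item from `D` whose only resources are pairwise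
shared keys along the edges of the key-sharing graph `H` and public (broadcast) communication.
Each player privately holds its own coins and the keys of its incident edges, and nothing else.
The receiver is fixed before the protocol starts; `senders` is the set of possible senders. -/
structure AnonProtocol (n : ℕ) (H : SimpleGraph (Fin n)) (D : Type*) where
  /-- Alphabet of transmitted messages. -/
  Msg : Type*
  /-- Private local randomness of each player (for the whole protocol). -/
  Coin : Fin n → Type*
  coinDist : (m : Fin n) → PMF (Coin m)
  /-- For each edge, the key shared by exactly its two endpoints (one uniform bit is the case
  `Key e = Bool` with the uniform distribution). -/
  Key : H.edgeSet → Type*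
  keyDist : (e : H.edgeSet) → PMF (Key e)
  /-- Number of rounds. -/
  rounds : ℕ
  /-- The message of player `m`, given its coins, its keys, its role (`some d` if it is the sender
  and wants to send `d`, `none` otherwise) and the list of all messages transmitted so far. The
  length of that list determines the current round. -/
  send : (m : Fin n) → Coin m → ((e : H.edgeSet) → m ∈ e.1 → Key e) → Option D → List Msg → Msg
  senders : Finset (Fin n)
  receiver : Fin n
  /-- The data item that the receiver reads off its coins, its keys and the communication. -/
  decode : Coin receiver → ((e : H.edgeSet) → receiver ∈ e.1 → Key e) → List Msg → D

namespace AnonProtocol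

variable {n : ℕ} {H : SimpleGraph (Fin n)} {D : Type*}

/-- The coins of all players and all shared keys. -/
abbrev Randomness (P : AnonProtocol n H D) : Type _ :=
  ((m : Fin n) → P.Coin m) × ((e : H.edgeSet) → P.Key e)

/-- The randomness held by player `m`: its coins and the keys of its incident edges. -/
abbrev Held (P : AnonProtocol n H D) (m : Fin n) : Type _ :=
  P.Coin m × ((e : H.edgeSet) → m ∈ e.1 → P.Key e)

/-- The part of the randomness that player `m` holds. -/
def held (P : AnonProtocol n H D) (ρ : P.Randomness) (m : Fin n) : P.Held m :=
  (ρ.1 m, fun e _ => ρ.2 e)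

open Classical in
/-- Probability of one outcome of the randomness: all coins and keys are independent. -/
noncomputable def weight (P : AnonProtocol n H D) (ρ : P.Randomness) : ℝ≥0∞ :=
  (∏ m, P.coinDist m (ρ.1 m)) * ∏ e, P.keyDist e (ρ.2 e)

/-- Probability of an event. -/
noncomputable def prob (P : AnonProtocol n H D) (A : Set P.Randomness) : ℝ≥0∞ :=
  ∑' ρ, A.indicator P.weight ρ

/-- The order of speaking: in each round the players transmit one after another. -/
def schedule (P : AnonProtocol n H D) : List (Fin n) :=
  (List.replicate P.rounds (List.finRange n)).flatten

/-- The total communication when player `s` sends `d` and everybody follows the protocol. -/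
def transcript (P : AnonProtocol n H D) (s : Fin n) (d : D) (ρ : P.Randomness) : List P.Msg :=
  P.schedule.foldl
    (fun C m => C ++ [P.send m (P.held ρ m).1 (P.held ρ m).2 (if m = s then some d else none) C]) []

/-- Whichever possible sender other than the receiver sends whichever data item, the receiver
obtains that item with probability one when everybody follows the protocol. -/
def Correct (P : AnonProtocol n H D) : Prop :=
  ∀ s ∈ P.senders, s ≠ P.receiver → ∀ d : D,
    P.prob {ρ | P.decode (P.held ρ P.receiver).1 (P.held ρ P.receiver).2
      (P.transcript s d ρ) = d} = 1

/-- What a collusion `T` sees: all communication and all randomness held by its members. -/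
abbrev View (P : AnonProtocol n H D) (T : Finset (Fin n)) : Type _ :=
  List P.Msg × ((m : T) → P.Held m)

/-- The view of `T` when player `s` sends `d`. -/
def view (P : AnonProtocol n H D) (T : Finset (Fin n)) (s : Fin n) (d : D) (ρ : P.Randomness) :
    P.View T :=
  (P.transcript s d ρ, fun m => P.held ρ m)

/-- The possible senders that do not belong to the collusion `T`. -/
def candidates (P : AnonProtocol n H D) (T : Finset (Fin n)) : Finset (Fin n) :=
  P.senders \ T

/-- Probability that the guess `S`, computed from the view of `T`, is the sender, when the sender
of `d` is uniformly distributed on the possible senders outside `T`. -/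
noncomputable def guessProb (P : AnonProtocol n H D) (T : Finset (Fin n)) (d : D)
    (S : P.View T → Fin n) : ℝ≥0∞ :=
  (∑ s ∈ P.candidates T, P.prob {ρ | S (P.view T s d ρ) = s}) / (P.candidates T).card

/-- The sender of every data item stays anonymous against the collusion `T`: the best guess
from the view of `T` is no better than the best guess without it. -/
def SenderAnonymousAgainst (P : AnonProtocol n H D) (T : Finset (Fin n)) : Prop :=
  ∀ d : D, IsGreatest (Set.range (P.guessProb T d)) (1 / ((P.candidates T).card : ℝ≥0∞))

/-- The collusion `T` can break the sender's anonymity, just by pooling what its members see: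
for some data item, some guess beats the a priori probability. -/
def CanBreakSenderAnonymity (P : AnonProtocol n H D) (T : Finset (Fin n)) : Prop :=
  ∃ (d : D) (S : P.View T → Fin n), 1 / ((P.candidates T).card : ℝ≥0∞) < P.guessProb T d S

end AnonProtocol

/-- The nodes `i` and `j` lie in different parts of what remains of `H` after removing `T`. -/
def SeparatedBy {V : Type*} (H : SimpleGraph V) (T : Finset V) (i j : V) : Prop :=
  i ∉ T ∧ j ∉ T ∧ ∀ p : H.Walk i j, ∃ v ∈ p.support, v ∈ T

/-! Let `X` be the component of one candidate `i` after deleting `T`, chosen not to contain the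
receiver, and let `j` be a candidate outside `X ∪ T`. Two runs that look alike to `T` can be glued
along `X` (`viewOf_mix`): `X` interacts with the rest only through the transcript and what `T`
holds. As coins and keys are independent, exchanging the `X`-parts of two runs preserves their joint
weight, so products of view probabilities survive an exchange of roles inside `X`
(`map_viewOf_mul`).

If `T` cannot beat the a priori guess, `i` and `j` sending `d` give the same law `h` of the view.
The exchange turns this pair into "nobody sends" and "both send", with laws `f` and `g` satisfying
`f * g = h * h`; equality in AM-GM forces `f = h` (`PMF.eq_of_mul_eq_sq`). So the view has the law
of silence, whatever `d` is. Gluing a run with `d` inside `X` to one with `d'` outside then makes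
the receiver decode `d'` although `d` was sent. -/

open scoped ENNReal

/-! ### Sums of products, the AM-GM equality case, and merged records -/

section Auxiliary

/-- In `ℝ≥0∞`, a finite product of sums is the sum over all choice functions of the products. -/
theorem ENNReal.tsum_pi_prod {ι : Type*} [Fintype ι] {β : ι → Type*} (f : ∀ i, β i → ℝ≥0∞) :
    ∑' x : (∀ i, β i), ∏ i, f i (x i) = ∏ i, ∑' b, f i b := by
  revert f
  revert β
  refine Fintype.induction_empty_option
    (P := fun ι [Fintype ι] => ∀ {β : ι → Type _} (f : ∀ i, β i → ℝ≥0∞),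
      ∑' x : (∀ i, β i), ∏ i, f i (x i) = ∏ i, ∑' b, f i b) ?_ ?_ ?_ ι
  · intro α α' _ e ih β f
    let _ : Fintype α := Fintype.ofEquiv α' e.symm
    rw [← e.prod_comp, ← ih (fun a => f (e a)), ← (Equiv.piCongrLeft β e).tsum_eq]
    refine tsum_congr fun x => ?_
    rw [← e.prod_comp]
    exact Finset.prod_congr rfl fun a _ => by rw [Equiv.piCongrLeft_apply_apply]
  · intro β f
    simp
  · intro α _ ih β f
    rw [Fintype.prod_option, ← ih, ← (Equiv.piOptionEquivProd (β := β)).symm.tsum_eq,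
      ENNReal.tsum_prod', ← ENNReal.tsum_mul_right]
    refine tsum_congr fun a => ?_
    rw [← ENNReal.tsum_mul_left]
    refine tsum_congr fun x => ?_
    rw [Fintype.prod_option]
    rfl

/-- AM-GM with its equality case; finiteness allows the passage to real numbers. -/
theorem ENNReal.two_mul_le_add_of_mul_eq_sq {x y z : ℝ≥0∞} (hx : x ≠ ∞) (hy : y ≠ ∞) (hz : z ≠ ∞)
    (h : x * y = z * z) : 2 * z ≤ x + y ∧ (x ≠ z → 2 * z < x + y) := by
  lift x to NNReal using hx
  lift y to NNReal using hy
  lift z to NNReal using hz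
  norm_cast at h ⊢
  have h' : (x : ℝ) * y = z * z := by exact_mod_cast h
  have hle : 2 * (z : ℝ) ≤ x + y := by
    refine (pow_le_pow_iff_left₀ (by positivity) (by positivity) two_ne_zero).1 ?_
    nlinarith [sq_nonneg ((x : ℝ) - y)]
  refine ⟨by exact_mod_cast hle, fun hne => ?_⟩
  have hlt : 2 * (z : ℝ) < x + y := by
    refine lt_of_le_of_ne hle fun heq => hne ?_
    have h0 : ((x : ℝ) - z) ^ 2 = 0 := by
      have hy : (y : ℝ) = 2 * z - x := by linarith
      rw [hy] at h'
      linarith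
    exact_mod_cast sub_eq_zero.1 (pow_eq_zero_iff two_ne_zero |>.1 h0)
  exact_mod_cast hlt

/-- A probability mass function that is the pointwise geometric mean of two others equals them. -/
theorem PMF.eq_of_mul_eq_sq {α : Type*} {f g h : PMF α} (hfg : ∀ a, f a * g a = h a * h a) :
    f = h := by
  by_contra hne
  obtain ⟨a, ha⟩ : ∃ a, f a ≠ h a := by
    by_contra! hall
    exact hne (PMF.ext hall)
  have key a := ENNReal.two_mul_le_add_of_mul_eq_sq (f.apply_ne_top a) (g.apply_ne_top a)
    (h.apply_ne_top a) (hfg a)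
  have hsum : ∑' a, 2 * h a = 2 := by rw [ENNReal.tsum_mul_left, h.tsum_coe, mul_one]
  have hsum' : ∑' a, (f a + g a) = 2 := by
    rw [ENNReal.tsum_add, f.tsum_coe, g.tsum_coe, one_add_one_eq_two]
  -- Both sums equal 2, so strictness at a single point is already absurd.
  have := ENNReal.tsum_lt_tsum (by rw [hsum]; exact ENNReal.ofNat_ne_top)
    (fun a => (key a).1) ((key a).2 ha)
  rw [hsum, hsum'] at this
  exact this.false

/-- If two sequential processes produce the same record, so does every process each of whose steps
follows one of the two. -/
theorem List.foldl_append_singleton_eq_of_forall_or {α β : Type*} {f g h : α → List β → β}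
    (l : List α) (hfg : l.foldl (fun C m => C ++ [f m C]) [] = l.foldl (fun C m => C ++ [g m C]) [])
    (hh : ∀ m, h m = f m ∨ h m = g m) :
    l.foldl (fun C m => C ++ [h m C]) [] = l.foldl (fun C m => C ++ [f m C]) [] := by
  induction l using List.reverseRecOn with
  | nil => rfl
  | append_singleton l m ih =>
    simp only [List.foldl_append, List.foldl_cons, List.foldl_nil] at hfg ⊢
    obtain ⟨hl, hm⟩ := List.append_inj' hfg rfl
    rw [ih hl]
    rw [← hl] at hm
    rcases hh m with h' | h' <;> rw [h']
    rw [← hm]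

end Auxiliary

/-! ### The probability law of coins and keys -/

namespace AnonProtocol

variable {n : ℕ} {H : SimpleGraph (Fin n)} {D : Type*} (P : AnonProtocol n H D)

theorem tsum_weight : ∑' ρ, P.weight ρ = 1 := by
  unfold weight
  rw [ENNReal.tsum_prod', ENNReal.tsum_comm]
  simp_rw [ENNReal.tsum_mul_right, ENNReal.tsum_pi_prod (fun m => P.coinDist m), PMF.tsum_coe,
    Finset.prod_const_one, one_mul]
  classical
  rw [ENNReal.tsum_pi_prod (fun e => P.keyDist e)]
  simp [PMF.tsum_coe]

/-- The joint law of all coins and keys. -/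
noncomputable def law : PMF P.Randomness :=
  ⟨P.weight, P.tsum_weight ▸ ENNReal.summable.hasSum⟩

theorem law_apply (ρ : P.Randomness) : P.law ρ = P.weight ρ := rfl

theorem prob_eq (A : Set P.Randomness) : P.prob A = P.law.toOuterMeasure A := by
  rw [PMF.toOuterMeasure_apply]; rfl

theorem prob_add_prob_compl (A : Set P.Randomness) : P.prob A + P.prob Aᶜ = 1 := by
  rw [prob, prob, ← ENNReal.tsum_add, ← P.tsum_weight]
  exact tsum_congr fun ρ => congrFun (Set.indicator_self_add_compl A P.weight) ρ

/-! ### Gluing executions along a set of players -/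

/-- The communication when the players have arbitrary roles, so that there may be no sender or
several of them. -/
def transcriptOf (R : Fin n → Option D) (ρ : P.Randomness) : List P.Msg :=
  P.schedule.foldl (fun C m => C ++ [P.send m (P.held ρ m).1 (P.held ρ m).2 (R m) C]) []

/-- The view of `T` when the players have arbitrary roles. -/
def viewOf (T : Finset (Fin n)) (R : Fin n → Option D) (ρ : P.Randomness) : P.View T :=
  (P.transcriptOf R ρ, fun m => P.held ρ m)

/-- The roles when `s` sends `d`. -/
def role (s : Fin n) (d : D) (m : Fin n) : Option D := if m = s then some d else none

open Classical in
/-- The randomness `ρ` on everything held inside `X`, and `ρ'` elsewhere. -/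
noncomputable def mix (X : Set (Fin n)) (ρ ρ' : P.Randomness) : P.Randomness :=
  (fun m => if m ∈ X then ρ.1 m else ρ'.1 m,
    fun e => if ∃ v ∈ e.1, v ∈ X then ρ.2 e else ρ'.2 e)

theorem mix_mix_self (X : Set (Fin n)) (ρ ρ' : P.Randomness) :
    P.mix X (P.mix X ρ ρ') (P.mix X ρ' ρ) = ρ := by
  refine Prod.ext (funext fun m => ?_) (funext fun e => ?_) <;>
    simp only [mix] <;> split_ifs <;> rfl

/-- Independence enters here: in the product of the two weights, each coin or key contributes the
same two factors, at most in exchanged order. -/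
theorem weight_mix_mul (X : Set (Fin n)) (ρ ρ' : P.Randomness) :
    P.weight (P.mix X ρ ρ') * P.weight (P.mix X ρ' ρ) = P.weight ρ * P.weight ρ' := by
  simp only [weight]
  rw [mul_mul_mul_comm, mul_mul_mul_comm (∏ m, P.coinDist m (ρ.1 m)), ← Finset.prod_mul_distrib,
    ← Finset.prod_mul_distrib, ← Finset.prod_mul_distrib, ← Finset.prod_mul_distrib]
  congr 1 <;> refine Finset.prod_congr rfl fun _ _ => ?_ <;> simp only [mix] <;>
    split_ifs <;> first | rfl | exact mul_comm _ _

/-- Exchanging in a pair of outcomes what is held inside `X`. -/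
noncomputable def swapEquiv (X : Set (Fin n)) :
    P.Randomness × P.Randomness ≃ P.Randomness × P.Randomness where
  toFun p := (P.mix X p.2 p.1, P.mix X p.1 p.2)
  invFun p := (P.mix X p.2 p.1, P.mix X p.1 p.2)
  left_inv p := Prod.ext (P.mix_mix_self X p.1 p.2) (P.mix_mix_self X p.2 p.1)
  right_inv p := Prod.ext (P.mix_mix_self X p.1 p.2) (P.mix_mix_self X p.2 p.1)

variable {P} {X : Set (Fin n)} {T : Finset (Fin n)}

theorem held_mix_of_mem {m : Fin n} (hm : m ∈ X) (ρ ρ' : P.Randomness) :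
    P.held (P.mix X ρ ρ') m = P.held ρ m := by
  refine Prod.ext (by simp [held, mix, hm]) ?_
  funext e he
  exact if_pos ⟨m, he, hm⟩

theorem held_mix_of_forall_not_mem {m : Fin n} (hm : m ∉ X) (hadj : ∀ v ∈ X, ¬ H.Adj v m)
    (ρ ρ' : P.Randomness) : P.held (P.mix X ρ ρ') m = P.held ρ' m := by
  refine Prod.ext (by simp [held, mix, hm]) ?_
  funext e he
  refine if_neg ?_
  rintro ⟨v, hve, hv⟩
  have hne : v ≠ m := fun h => hm (h ▸ hv)
  have hev : e.1 = s(v, m) := ((Sym2.mem_and_mem_iff hne).1 ⟨hve, he⟩)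
  exact hadj v hv (by rw [← SimpleGraph.mem_edgeSet, ← hev]; exact e.2)

/-- Meant for members of `T`: their keys may come from both sides of the mixture, but there the two
sources agree. -/
theorem held_mix_of_held_eq {m : Fin n} {ρ ρ' : P.Randomness} (h : P.held ρ m = P.held ρ' m) :
    P.held (P.mix X ρ ρ') m = P.held ρ' m := by
  have h1 : ρ.1 m = ρ'.1 m := congrArg Prod.fst h
  have h2 e (he : m ∈ e.1) : ρ.2 e = ρ'.2 e := congrFun (congrFun (congrArg Prod.snd h) e) he
  refine Prod.ext (by simp [held, mix, h1]) ?_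
  funext e he
  simp [held, mix, h2 e he]

/-- If `X` has no edges leaving `X ∪ T`, two executions that look the same to `T` can be glued
together along `X` without `T` noticing. -/
theorem viewOf_mix (hXT : ∀ v ∈ X, ∀ w, H.Adj v w → w ∈ X ∨ w ∈ T)
    {R R' R'' : Fin n → Option D} (hR : ∀ m ∈ X, R'' m = R m) (hR' : ∀ m ∉ X, R'' m = R' m)
    {ρ ρ' : P.Randomness} (h : P.viewOf T R ρ = P.viewOf T R' ρ') :
    P.viewOf T R'' (P.mix X ρ ρ') = P.viewOf T R' ρ' := by
  have hC : P.transcriptOf R ρ = P.transcriptOf R' ρ' := congrArg Prod.fst h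
  have hT m (hm : m ∈ T) : P.held ρ m = P.held ρ' m :=
    congrFun (congrArg Prod.snd h) (⟨m, hm⟩ : T)
  refine Prod.ext ?_ (funext fun m => held_mix_of_held_eq (hT m m.2))
  change P.transcriptOf R'' _ = P.transcriptOf R' _
  -- Each player acts as in one of two runs with a common transcript: those in `X` as in `ρ`, all
  -- others as in `ρ'`.
  refine List.foldl_append_singleton_eq_of_forall_or
    (f := fun m => P.send m (P.held ρ' m).1 (P.held ρ' m).2 (R' m))
    (g := fun m => P.send m (P.held ρ m).1 (P.held ρ m).2 (R m))
    (h := fun m => P.send m (P.held (P.mix X ρ ρ') m).1 (P.held (P.mix X ρ ρ') m).2 (R'' m))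
    P.schedule hC.symm fun m => ?_
  by_cases hm : m ∈ X
  · right
    rw [held_mix_of_mem hm, hR m hm]
  · left
    have : P.held (P.mix X ρ ρ') m = P.held ρ' m := by
      by_cases hmT : m ∈ T
      · exact held_mix_of_held_eq (hT m hmT)
      · exact held_mix_of_forall_not_mem hm
          (fun v hv hadj => (hXT v hv m hadj).elim hm hmT) ρ ρ'
    rw [this, hR' m hm]

/-- Exchanging the roles inside `X` between two role assignments preserves the product of the
probabilities of a view. -/
theorem map_viewOf_mul (hXT : ∀ v ∈ X, ∀ w, H.Adj v w → w ∈ X ∨ w ∈ T)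
    {R S R' S' : Fin n → Option D}
    (hR : ∀ m ∈ X, R' m = S m) (hR' : ∀ m ∉ X, R' m = R m)
    (hS : ∀ m ∈ X, S' m = R m) (hS' : ∀ m ∉ X, S' m = S m) (v : P.View T) :
    P.law.map (P.viewOf T R) v * P.law.map (P.viewOf T S) v =
      P.law.map (P.viewOf T R') v * P.law.map (P.viewOf T S') v := by
  classical
  have expand (R S : Fin n → Option D) :
      P.law.map (P.viewOf T R) v * P.law.map (P.viewOf T S) v =
        ∑' p : P.Randomness × P.Randomness,
          if v = P.viewOf T R p.1 ∧ v = P.viewOf T S p.2 then P.weight p.1 * P.weight p.2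
          else 0 := by
    rw [PMF.map_apply, PMF.map_apply, ← ENNReal.tsum_mul_right,
      ENNReal.tsum_prod' (α := P.Randomness) (β := P.Randomness)]
    refine tsum_congr fun ρ => ?_
    rw [← ENNReal.tsum_mul_left]
    refine tsum_congr fun ρ' => ?_
    by_cases h1 : v = P.viewOf T R ρ <;> by_cases h2 : v = P.viewOf T S ρ' <;>
      simp [h1, h2, law_apply]
  -- The product counts independent pairs of runs that both show `v`; exchanging `X`-parts is a
  -- weight-preserving bijection between the two kinds of pairs.
  rw [expand, expand, ← (P.swapEquiv X).tsum_eq]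
  refine tsum_congr ?_
  rintro ⟨ρ, ρ'⟩
  simp only [swapEquiv, Equiv.coe_fn_mk]
  rw [P.weight_mix_mul X ρ' ρ, mul_comm (P.weight ρ')]
  refine if_congr ⟨fun ⟨h1, h2⟩ => ?_, fun ⟨h1, h2⟩ => ?_⟩ rfl rfl
  · have e1 := viewOf_mix hXT hR hR' (h2.symm.trans h1)
    have e2 := viewOf_mix hXT hS hS' (h1.symm.trans h2)
    rw [P.mix_mix_self] at e1 e2
    exact ⟨h1.trans e1.symm, h2.trans e2.symm⟩
  · exact ⟨h1.trans (viewOf_mix hXT (fun m hm => (hS m hm).symm)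
        (fun m hm => (hR' m hm).symm) (h2.symm.trans h1)).symm,
      h2.trans (viewOf_mix hXT (fun m hm => (hR m hm).symm)
        (fun m hm => (hS' m hm).symm) (h1.symm.trans h2)).symm⟩

/-! ### From failing guesses to incorrect decoding -/

/-- If `T` cannot beat the a priori guess, no view is likelier for one candidate than for another. -/
theorem map_view_le_of_not_canBreak (h : ¬ P.CanBreakSenderAnonymity T) {i j : Fin n}
    (hi : i ∈ P.candidates T) (hj : j ∈ P.candidates T) (hij : i ≠ j) (d : D) (v : P.View T) :
    P.law.map (P.view T i d) v ≤ P.law.map (P.view T j d) v := by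
  classical
  have map_eq (s : Fin n) :
      P.law.map (P.view T s d) v = P.prob {ρ | P.view T s d ρ = v} := by
    rw [PMF.map_apply, prob]
    refine tsum_congr fun ρ => ?_
    simp [Set.indicator_apply, eq_comm, law_apply]
  rw [map_eq, map_eq]
  have hc : ((P.candidates T).card : ℝ≥0∞) ≠ 0 := by
    exact_mod_cast Finset.card_ne_zero_of_mem hi
  -- This guess succeeds on `i` with the probability of `v` under `i`, and on `j` with one minus
  -- that under `j`; a total of at most 1 is the claimed inequality.
  let S : P.View T → Fin n := fun w => if w = v then i else j
  have hS : P.guessProb T d S ≤ 1 / ((P.candidates T).card : ℝ≥0∞) :=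
    not_lt.1 fun hlt => h ⟨d, S, hlt⟩
  have hsum : ∑ s ∈ P.candidates T, P.prob {ρ | S (P.view T s d ρ) = s} ≤ 1 := by
    rwa [guessProb, ENNReal.div_le_iff hc (ENNReal.natCast_ne_top _),
      ENNReal.div_mul_cancel hc (ENNReal.natCast_ne_top _)] at hS
  have hpair := (Finset.sum_le_sum_of_subset
    (f := fun s => P.prob {ρ | S (P.view T s d ρ) = s})
    (Finset.insert_subset hi (Finset.singleton_subset_iff.2 hj))).trans hsum
  rw [Finset.sum_pair hij] at hpair
  have hSi : {ρ | S (P.view T i d ρ) = i} = {ρ | P.view T i d ρ = v} := by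
    ext ρ
    simp [S, hij.symm]
  have hSj : {ρ | S (P.view T j d ρ) = j} = {ρ | P.view T j d ρ = v}ᶜ := by
    ext ρ
    simp [S, hij]
  rw [hSi, hSj, ← P.prob_add_prob_compl {ρ | P.view T j d ρ = v}] at hpair
  refine (ENNReal.add_le_add_iff_right ?_).1 hpair
  exact ne_top_of_le_ne_top ENNReal.one_ne_top
    (le_add_self.trans (P.prob_add_prob_compl {ρ | P.view T j d ρ = v}).le)

/-- If all edges from `X` lead to `X ∪ T` and the receiver lies outside `X`, then `T` can break the
sender's anonymity as soon as there are candidates both inside and outside `X`. -/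
theorem canBreak_of_boundary [Nontrivial D] (hP : P.Correct)
    (hXT : ∀ v ∈ X, ∀ w, H.Adj v w → w ∈ X ∨ w ∈ T) (hr : P.receiver ∉ X)
    {i j : Fin n} (hi : i ∈ P.candidates T) (hj : j ∈ P.candidates T) (hiX : i ∈ X) (hjX : j ∉ X) :
    P.CanBreakSenderAnonymity T := by
  classical
  by_contra hbreak
  have hij : i ≠ j := fun h => hjX (h ▸ hiX)
  have hsame (d : D) : P.law.map (P.viewOf T (role i d)) = P.law.map (P.viewOf T (role j d)) :=
    PMF.ext fun v => le_antisymm (map_view_le_of_not_canBreak hbreak hi hj hij d v)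
      (map_view_le_of_not_canBreak hbreak hj hi hij.symm d v)
  have hquiet (d : D) :
      P.law.map (P.viewOf T fun _ => none) = P.law.map (P.viewOf T (role i d)) := by
    -- The companion `g` is the law of the view when `i` and `j` both send `d`.
    refine PMF.eq_of_mul_eq_sq
      (g := P.law.map (P.viewOf T fun m => if m ∈ X then role i d m else role j d m)) fun v => ?_
    nth_rewrite 2 [hsame d]
    refine map_viewOf_mul hXT (X := X) ?_ ?_ ?_ ?_ v
    · intro m hm
      rw [if_pos hm]
    · intro m hm
      exact if_neg fun h : m = i => hm (h ▸ hiX)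
    · intro m hm
      exact if_neg fun h : m = j => hjX (h ▸ hm)
    · intro m hm
      rw [if_neg hm]
  obtain ⟨d, d', hd⟩ := exists_pair_ne D
  obtain ⟨ρ, hρ⟩ := P.law.support_nonempty
  -- Both laws equal that of silence, so a possible view for `d` is possible for `d'`.
  have hmem : P.viewOf T (role i d) ρ ∈ (P.law.map (P.viewOf T (role i d'))).support := by
    rw [← hquiet d', hquiet d, PMF.mem_support_map_iff]
    exact ⟨ρ, hρ, rfl⟩
  obtain ⟨ρ', hρ', hview⟩ := (PMF.mem_support_map_iff _ _ _).1 hmem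
  have hdec (e : D) (ρ : P.Randomness) (hρ : ρ ∈ P.law.support) :
      P.decode (P.held ρ P.receiver).1 (P.held ρ P.receiver).2 (P.transcript i e ρ) = e := by
    have := hP i (Finset.mem_sdiff.1 hi).1 (fun h => hr (h ▸ hiX)) e
    rw [prob_eq, PMF.toOuterMeasure_apply_eq_one_iff] at this
    exact this hρ
  have hmix : P.mix X ρ ρ' ∈ P.law.support := by
    have h0 : P.weight ρ * P.weight ρ' ≠ 0 := mul_ne_zero hρ hρ'
    rw [← P.weight_mix_mul X] at h0
    exact left_ne_zero_of_mul h0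
  have hviewmix : P.viewOf T (role i d) (P.mix X ρ ρ') = P.viewOf T (role i d') ρ' := by
    refine viewOf_mix hXT (R := role i d) (fun _ _ => rfl) (fun m hm => ?_) hview.symm
    have hmi : m ≠ i := fun h => hm (h ▸ hiX)
    simp [role, hmi]
  have hheld : P.held (P.mix X ρ ρ') P.receiver = P.held ρ' P.receiver := by
    by_cases hrT : P.receiver ∈ T
    · exact congrFun (congrArg Prod.snd hviewmix) (⟨P.receiver, hrT⟩ : T)
    · exact held_mix_of_forall_not_mem hr
        (fun v hv hadj => (hXT v hv _ hadj).elim hr hrT) ρ ρ'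
  have hC : P.transcript i d (P.mix X ρ ρ') = P.transcript i d' ρ' := congrArg Prod.fst hviewmix
  have h1 := hdec d _ hmix
  rw [hheld, hC, hdec d' ρ' hρ'] at h1
  exact hd h1.symm

end AnonProtocol

/-! ### Components of the graph without `T` -/

namespace SimpleGraph

variable {V : Type*} (H : SimpleGraph V) (T : Finset V)

/-- The nodes that can be reached from `i` without meeting `T`. -/
def reachAvoiding (i : V) : Set V :=
  {v | ∃ p : H.Walk i v, ∀ w ∈ p.support, w ∉ T}

variable {H T}

theorem self_mem_reachAvoiding {i : V} (hi : i ∉ T) : i ∈ H.reachAvoiding T i :=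
  ⟨.nil, by simpa using hi⟩

theorem reachAvoiding_boundary {i v : V} (hv : v ∈ H.reachAvoiding T i) (w : V) (hvw : H.Adj v w) :
    w ∈ H.reachAvoiding T i ∨ w ∈ T := by
  obtain ⟨p, hp⟩ := hv
  by_cases hw : w ∈ T
  · exact .inr hw
  · refine .inl ⟨p.concat hvw, fun u hu => ?_⟩
    rw [Walk.support_concat, List.mem_append, List.mem_singleton] at hu
    rcases hu with hu | rfl
    exacts [hp u hu, hw]

end SimpleGraph

theorem SeparatedBy.symm {V : Type*} {H : SimpleGraph V} {T : Finset V} {i j : V}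
    (h : SeparatedBy H T i j) : SeparatedBy H T j i :=
  ⟨h.2.1, h.1, fun p => by simpa using h.2.2 p.reverse⟩

theorem SeparatedBy.not_mem_reachAvoiding {V : Type*} {H : SimpleGraph V} {T : Finset V} {i j v : V}
    (h : SeparatedBy H T i j) (hi : v ∈ H.reachAvoiding T i) : v ∉ H.reachAvoiding T j := by
  rintro ⟨q, hq⟩
  obtain ⟨p, hp⟩ := hi
  obtain ⟨w, hw, hwT⟩ := h.2.2 (p.append q.reverse)
  rw [SimpleGraph.Walk.mem_support_append_iff, SimpleGraph.Walk.support_reverse,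
    List.mem_reverse] at hw
  exact hw.elim (fun hw => hp w hw hwT) (fun hw => hq w hw hwT)

theorem mainTheorem2 {n : ℕ} {H : SimpleGraph (Fin n)} {D : Type*} [Nontrivial D]
    (P : AnonProtocol n H D) (hP : P.Correct) (T : Finset (Fin n))
    (hT : ∃ i ∈ P.senders, ∃ j ∈ P.senders, SeparatedBy H T i j) :
    P.CanBreakSenderAnonymity T ∧ ¬ P.SenderAnonymousAgainst T := by
  have hbreak : P.CanBreakSenderAnonymity T := by
    obtain ⟨i, hi, j, hj, hsep⟩ := hT
    have aux {i j : Fin n} (hi : i ∈ P.senders) (hj : j ∈ P.senders) (hsep : SeparatedBy H T i j)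
        (hr : P.receiver ∉ H.reachAvoiding T i) : P.CanBreakSenderAnonymity T :=
      AnonProtocol.canBreak_of_boundary hP
        (fun _ hv => SimpleGraph.reachAvoiding_boundary hv) hr
        (Finset.mem_sdiff.2 ⟨hi, hsep.1⟩) (Finset.mem_sdiff.2 ⟨hj, hsep.2.1⟩)
        (SimpleGraph.self_mem_reachAvoiding hsep.1)
        (hsep.symm.not_mem_reachAvoiding (SimpleGraph.self_mem_reachAvoiding hsep.2.1))
    -- The components of `i` and `j` are disjoint, so at least one of them misses the receiver.
    by_cases hr : P.receiver ∈ H.reachAvoiding T i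
    · exact aux hj hi hsep.symm (hsep.not_mem_reachAvoiding hr)
    · exact aux hi hj hsep hr
  refine ⟨hbreak, fun hanon => ?_⟩
  obtain ⟨d, S, hlt⟩ := hbreak
  exact hlt.not_ge ((hanon d).2 ⟨S, rfl⟩)
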